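/- Let $U$ be an open subset of a complex Banach space $E$ and let $F$ be a complex Banach space. Let $\mathcal H^\infty(U,F)$ be the space of bounded holomorphic mappings $U\to F$ with the supremum norm, and write $\mathcal H^\infty(U)=\mathcal H^\infty(U,\mathbb C)$. Let $\mathcal G^\infty(U)$ be the norm-closed linear span in $\mathcal H^\infty(U)^*$ of the evaluation functionals $\delta(x)\colon h\mapsto h(x)$, $x\in U$, and let $\delta_U\colon U\to\mathcal G^\infty(U)$ be the mapping $x\mapsto\delta(x)$. For $f\in\mathcal H^\infty(U,F)$, let $T_f\colon\mathcal G^\infty(U)\to F$ be the unique bounded linear operator with $T_f\circ\delta_U=f$ (its Mujica linearization), and let $f^t\colon F^*\to\mathcal H^\infty(U)$ be the transpose $f^t(\varphi)=\varphi\circ f$. A bounded linear operator $T\colon X\to Y$ between Banach spaces is called weakly compact if the image of the closed unit ball of $X$ is relatively weakly compact in $Y$. Then, for every $f\in\mathcal H^\infty(U,F)$, the following are equivalent: 1. $f$ has relatively weakly compact range, that is, $f(U)$ is relatively weakly compact in $F$. 2. $T_f\colon\mathcal G^\infty(U)\to F$ is weakly compact. 3. There exist a reflexive complex Banach space $G$,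 a bounded linear operator $T\colon G\to F$ and a mapping $g\in\mathcal H^\infty(U,G)$ such that $f=T\circ g$. 4. $f^t\colon F^*\to\mathcal H^\infty(U)$ is weakly compact. 5. $f^t\colon F^*\to\mathcal H^\infty(U)$ is weak*-to-weak continuous, that is, continuous from the weak* topology of $F^*$ to the weak topology of $\mathcal H^\infty(U)$. -/

import Mathlib

open TopologicalSpace BoundedContinuousFunction

universe u v

noncomputable section

namespace BddHolo

variable {E : Type u} [NormedAddCommGroup E] [NormedSpace ℂ E]
variable {F : Type v} [NormedAddCommGroup F] [NormedSpace ℂ F]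

/-- The bounded holomorphic mappings from the open set `U` to `F`, as a linear subspace of the
bounded continuous mappings `U → F`. Holomorphic means complex Fréchet differentiable at every point
of `U`; since mappings on `U` are functions on a subtype, this is phrased through an extension to
`E`, whose values outside `U` are irrelevant. -/
def hInftySubmodule (U : Opens E) (F : Type v) [NormedAddCommGroup F] [NormedSpace ℂ F] :
    Submodule ℂ (U →ᵇ F) where
  carrier := {f | ∃ h : E → F, DifferentiableOn ℂ h (U : Set E) ∧ ∀ x : U, h x = f x}
  add_mem' := by
    rintro f₁ f₂ ⟨h₁, d₁, e₁⟩ ⟨h₂, d₂, e₂⟩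
    exact ⟨h₁ + h₂, d₁.add d₂, fun x => by simp [e₁, e₂]⟩
  zero_mem' := ⟨fun _ => 0, differentiableOn_const 0, fun _ => rfl⟩
  smul_mem' := by
    rintro c f ⟨h, d, e⟩
    exact ⟨c • h, d.const_smul c, fun x => by simp [e]⟩

/-- The space `H^∞(U, F)` of bounded holomorphic mappings from `U` to `F`, normed by the supremum
norm over `U`. -/
def HInfty (U : Opens E) (F : Type v) [NormedAddCommGroup F] [NormedSpace ℂ F] : Type (max u v) :=
  hInftySubmodule U F

instance (U : Opens E) : NormedAddCommGroup (HInfty U F) :=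
  inferInstanceAs (NormedAddCommGroup (hInftySubmodule U F))

instance (U : Opens E) : NormedSpace ℂ (HInfty U F) :=
  inferInstanceAs (NormedSpace ℂ (hInftySubmodule U F))

instance (U : Opens E) : CoeFun (HInfty U F) (fun _ => U → F) := ⟨fun f => f.1⟩

theorem HInfty.norm_apply_le {U : Opens E} (f : HInfty U F) (x : U) : ‖f x‖ ≤ ‖f‖ :=
  f.1.norm_coe_le_norm x

theorem HInfty.norm_le {U : Opens E} (f : HInfty U F) {C : ℝ} (hC : 0 ≤ C) :
    ‖f‖ ≤ C ↔ ∀ x : U, ‖f x‖ ≤ C :=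
  BoundedContinuousFunction.norm_le hC

/-- Every mapping `h` that is holomorphic and bounded on `U` restricts to an element of
`H^∞(U, F)`. -/
theorem HInfty.exists_of_bounded (U : Opens E) (h : E → F) (hd : DifferentiableOn ℂ h (U : Set E))
    (C : ℝ) (hC : ∀ x ∈ U, ‖h x‖ ≤ C) : ∃ f : HInfty U F, ∀ x : U, f x = h x :=
  ⟨⟨BoundedContinuousFunction.ofNormedAddCommGroup (fun x : U => h x)
      (continuousOn_iff_continuous_domRestrict.1 hd.continuousOn) C (fun x => hC x x.2),
    h, hd, fun _ => rfl⟩, fun _ => rfl⟩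

/-- The evaluation functional `δ(x) : f ↦ f x` on `H^∞(U) = H^∞(U, ℂ)`. -/
def delta (U : Opens E) (x : U) : StrongDual ℂ (HInfty U ℂ) :=
  LinearMap.mkContinuous
    { toFun := fun f => f x
      map_add' := fun _ _ => rfl
      map_smul' := fun _ _ => rfl } 1
    (fun f => (f.norm_apply_le x).trans (one_mul ‖f‖).ge)

@[simp] theorem delta_apply (U : Opens E) (x : U) (f : HInfty U ℂ) : delta U x f = f x := rfl

/-- The norm-closed linear span of `{δ(x) : x ∈ U}` in the dual space `H^∞(U)^*`. -/
def gInftySubmodule (U : Opens E) : Submodule ℂ (StrongDual ℂ (HInfty U ℂ)) :=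
  (Submodule.span ℂ (Set.range (delta U))).topologicalClosure

/-- The space `G^∞(U)`: the norm-closed linear span of `{δ(x) : x ∈ U}` in `H^∞(U)^*`, with the
norm of `H^∞(U)^*`. -/
def GInfty (U : Opens E) : Type u := gInftySubmodule U

instance (U : Opens E) : NormedAddCommGroup (GInfty U) :=
  inferInstanceAs (NormedAddCommGroup (gInftySubmodule U))

instance (U : Opens E) : NormedSpace ℂ (GInfty U) :=
  inferInstanceAs (NormedSpace ℂ (gInftySubmodule U))

/-- The inclusion of `G^∞(U)` into `H^∞(U)^*`. -/
def GInfty.incl (U : Opens E) : GInfty U →ₗᵢ[ℂ] StrongDual ℂ (HInfty U ℂ) :=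
  (gInftySubmodule U).subtypeₗᵢ

/-- The mapping `δ_U : U → G^∞(U)`, `x ↦ δ(x)`. -/
def deltaU (U : Opens E) (x : U) : GInfty U :=
  ⟨delta U x, Submodule.le_topologicalClosure _ (Submodule.subset_span ⟨x, rfl⟩)⟩

theorem GInfty.incl_deltaU (U : Opens E) (x : U) : GInfty.incl U (deltaU U x) = delta U x := rfl

theorem GInfty.dense_span (U : Opens E) :
    Dense (Submodule.span ℂ (Set.range (deltaU U)) : Set (GInfty U)) := by
  intro γ
  rw [(GInfty.incl U).isometry.isEmbedding.closure_eq_preimage_closure_image]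
  have h1 : (GInfty.incl U '' (Submodule.span ℂ (Set.range (deltaU U)) : Set (GInfty U))) =
      (Submodule.span ℂ (Set.range (delta U)) : Set (StrongDual ℂ (HInfty U ℂ))) := by
    have h2 := Submodule.map_span (GInfty.incl U).toLinearMap (Set.range (deltaU U))
    rw [← Set.range_comp] at h2
    exact congrArg SetLike.coe h2
  rw [h1]
  exact γ.2

/-- The transpose `f^t : F^* → H^∞(U)`, `φ ↦ φ ∘ f`, of `f ∈ H^∞(U, F)`. -/
def transpose {U : Opens E} (f : HInfty U F) : StrongDual ℂ F →L[ℂ] HInfty U ℂ :=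
  LinearMap.mkContinuous
    { toFun := fun φ => ⟨φ.compLeftContinuousBounded U f.1, by
        obtain ⟨h, d, e⟩ := f.2
        exact ⟨fun x => φ (h x), φ.differentiable.comp_differentiableOn d, fun x => by simp [e]⟩⟩
      map_add' := fun _ _ => rfl
      map_smul' := fun _ _ => rfl } ‖f‖
    (fun φ => by
      refine (HInfty.norm_le _ (by positivity)).2 fun x => ?_
      rw [mul_comm]
      exact (φ.le_opNorm _).trans (mul_le_mul_of_nonneg_left (f.norm_apply_le x) (norm_nonneg _)))

@[simp] theorem transpose_apply {U : Opens E} (f : HInfty U F) (φ : StrongDual ℂ F) (x : U) :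
    transpose f φ x = φ (f x) := rfl

/-- Every `γ ∈ G^∞(U)` is represented by a vector of `F` through `f`: the adjoint of `f^t` maps
`G^∞(U)` into the canonical copy of `F` in `F^{**}`. -/
theorem exists_linearization_apply [CompleteSpace F] {U : Opens E} (f : HInfty U F)
    (γ : GInfty U) :
    ∃ y : F, ∀ φ : StrongDual ℂ F, φ y = GInfty.incl U γ (transpose f φ) := by
  let J := NormedSpace.inclusionInDoubleDualLi (E := F) ℂ
  let A : GInfty U →L[ℂ] StrongDual ℂ (StrongDual ℂ F) :=
    ContinuousLinearMap.precomp ℂ (transpose f) ∘L (GInfty.incl U).toContinuousLinearMap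
  have hcl : IsClosed {w : GInfty U | A w ∈ Set.range J} :=
    (J.isometry.isUniformInducing.isComplete_range.isClosed).preimage A.continuous
  have hsp : ∀ w ∈ Submodule.span ℂ (Set.range (deltaU U)), A w ∈ Set.range J := by
    intro w hw
    induction hw using Submodule.span_induction with
    | mem w hw =>
      obtain ⟨x, rfl⟩ := hw
      exact ⟨f x, by ext φ; rfl⟩
    | zero => exact ⟨0, by ext φ; rw [map_zero A]; exact map_zero φ⟩
    | add w z _ _ hw hz =>
      obtain ⟨a, ha⟩ := hw
      obtain ⟨b, hb⟩ := hz
      refine ⟨a + b, ?_⟩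
      ext φ
      have h1 : φ a = A w φ := DFunLike.congr_fun ha φ
      have h2 : φ b = A z φ := DFunLike.congr_fun hb φ
      rw [map_add A]
      exact (map_add φ a b).trans (congrArg₂ (· + ·) h1 h2)
    | smul c w _ hw =>
      obtain ⟨a, ha⟩ := hw
      refine ⟨c • a, ?_⟩
      ext φ
      have h1 : φ a = A w φ := DFunLike.congr_fun ha φ
      rw [map_smul A]
      exact (map_smul φ c a).trans (congrArg (c • ·) h1)
  obtain ⟨y, hy⟩ := hcl.closure_subset_iff.2 hsp (GInfty.dense_span U γ)
  exact ⟨y, fun φ => DFunLike.congr_fun hy φ⟩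

/-- The linearization `T_f : G^∞(U) → F` of `f ∈ H^∞(U, F)`: `T_f γ` is the vector of `F` with
`φ (T_f γ) = γ (φ ∘ f)` for all `φ ∈ F^*`. By `existsUnique_linearization`, `T_f` is the unique
bounded linear operator `T : G^∞(U) → F` with `T ∘ δ_U = f`. -/
def linearization [CompleteSpace F] {U : Opens E} (f : HInfty U F) : GInfty U →L[ℂ] F :=
  LinearMap.mkContinuous
    { toFun := fun γ => (exists_linearization_apply f γ).choose
      map_add' := fun γ η => (SeparatingDual.eq_iff_forall_dual_eq (R := ℂ)).2 fun φ => by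
        rw [(exists_linearization_apply f (γ + η)).choose_spec φ, map_add φ,
          (exists_linearization_apply f γ).choose_spec φ,
          (exists_linearization_apply f η).choose_spec φ, map_add (GInfty.incl U)]
        rfl
      map_smul' := fun c γ => (SeparatingDual.eq_iff_forall_dual_eq (R := ℂ)).2 fun φ => by
        rw [(exists_linearization_apply f (c • γ)).choose_spec φ, map_smul φ,
          (exists_linearization_apply f γ).choose_spec φ, map_smul (GInfty.incl U)]
        rfl }
    ‖transpose f‖
    (fun γ => NormedSpace.norm_le_dual_bound ℂ _ (by positivity) fun φ => by
      have h1 := (GInfty.incl U γ).le_opNorm (transpose f φ)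
      have h2 := (transpose f).le_opNorm φ
      rw [(GInfty.incl U).norm_map] at h1
      change ‖φ (exists_linearization_apply f γ).choose‖ ≤ _
      rw [(exists_linearization_apply f γ).choose_spec φ]
      calc _ ≤ _ := h1
        _ ≤ ‖γ‖ * (‖transpose f‖ * ‖φ‖) := by gcongr
        _ = _ := by ring)

theorem apply_linearization [CompleteSpace F] {U : Opens E} (f : HInfty U F) (γ : GInfty U)
    (φ : StrongDual ℂ F) : φ (linearization f γ) = GInfty.incl U γ (transpose f φ) :=
  (exists_linearization_apply f γ).choose_spec φ

theorem linearization_deltaU [CompleteSpace F] {U : Opens E} (f : HInfty U F) (x : U) :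
    linearization f (deltaU U x) = f x :=
  (SeparatingDual.eq_iff_forall_dual_eq (R := ℂ)).2 fun φ => apply_linearization f _ φ

theorem eq_linearization [CompleteSpace F] {U : Opens E} (f : HInfty U F) (T : GInfty U →L[ℂ] F)
    (hT : ∀ x : U, T (deltaU U x) = f x) : T = linearization f := by
  refine ContinuousLinearMap.ext_on (GInfty.dense_span U) ?_
  rintro _ ⟨x, rfl⟩
  rw [hT, linearization_deltaU]

theorem existsUnique_linearization [CompleteSpace F] {U : Opens E} (f : HInfty U F) :
    ∃! T : GInfty U →L[ℂ] F, ∀ x : U, T (deltaU U x) = f x :=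
  ⟨linearization f, linearization_deltaU f, eq_linearization f⟩

/-- A subset of a normed space is relatively weakly compact if its closure in the weak topology is
compact in the weak topology. -/
def IsRelWeaklyCompact (A : Set F) : Prop :=
  IsCompact (closure (toWeakSpace ℂ F '' A))

/-- A bounded linear operator is weakly compact if it maps the closed unit ball onto a relatively
weakly compact set. -/
def IsWeaklyCompactOp {X : Type*} [NormedAddCommGroup X] [NormedSpace ℂ X] (T : X →L[ℂ] F) :
    Prop :=
  IsRelWeaklyCompact (T '' Metric.closedBall (0 : X) 1)

/-- A normed space is reflexive if its canonical embedding into its bidual is onto. -/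
def IsReflexiveSpace (G : Type*) [NormedAddCommGroup G] [NormedSpace ℂ G] : Prop :=
  Function.Surjective (NormedSpace.inclusionInDoubleDual ℂ G)

/-- A bounded linear operator from a dual space `F^*` to `X` is weak*-to-weak continuous if it is
continuous from the weak* topology of `F^*` to the weak topology of `X`. -/
def IsWeakStarToWeakContinuous {X : Type*} [NormedAddCommGroup X] [NormedSpace ℂ X]
    (S : StrongDual ℂ F →L[ℂ] X) : Prop :=
  Continuous (fun φ : WeakDual ℂ F => toWeakSpace ℂ X (S (WeakDual.toStrongDual φ)))

end BddHolo

end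

/-!
All five conditions are equivalent to `AdjointMapsIntoPredual (transpose f)`: the adjoint of `f^t`
maps the whole dual of `H^∞(U)`, and not only `G^∞(U)`, into `F ⊆ F^{**}`.

If `f(U)` is relatively weakly compact and `μ ∈ H^∞(U)^*`, then `|μ (φ ∘ f)|` is at most `‖μ‖` times
the supremum of `|φ|` over `f(U)`, so `μ ∘ f^t` lies in `F` by Krein's theorem, in the form
`mem_range_inclusion_of_isRelWeaklyCompact`. The condition on the adjoint says that every `μ ∘ f^t`
is weak* continuous, that is, `f^t` is weak*-to-weak continuous, and then `f^t` is weakly compact by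
Banach–Alaoglu. Conversely, if `f^t` is weakly compact, weak and pointwise convergence agree on the
image of the ball, so every `μ ∘ f^t` is weak* continuous on the ball, and such functionals lie in
`F` (`mem_range_inclusion_of_continuousOn_ball`). The adjoint is then weak*-to-weak continuous into
`F` and extends `T_f`, so `T_f` is weakly compact; and `f(U)` is contained in the image of the unit
ball under `T_f`.

The reflexive factorization is the construction of Davis, Figiel, Johnson and Pełczyński, carried
out on the dual side. With the equivalent norms `2ⁿ‖f^t φ‖ + 2⁻ⁿ‖φ‖` on `F^*`, the space `G`
consists of the `x ∈ F` whose predual norms are square summable. An element of `G^{**}` induces a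
functional on `F^*` which, by splitting these norms with Hahn–Banach, is approximated by functionals
`μ ∘ f^t`; it is therefore a vector of `F`, and `G` is reflexive
(`isReflexiveSpace_interpSubmodule`). The mapping `f` takes values in `G`, and it is holomorphic as
such because its copies under the successive norms form a series dominated by `∑ 2⁻ⁿ`.
-/

noncomputable section

namespace BddHolo

open Filter Topology Set
open scoped ENNReal

/-! ### Convex combinations of pointwise null sequences -/

/-- Otherwise the convex hull is disjoint from the open convex set of functions below `δ`. A
separating functional is positive, so it is integration against a finite measure, and dominated
convergence gives a contradiction. -/
theorem exists_mem_convexHull_forall_lt {X : Type*} [TopologicalSpace X] [CompactSpace X]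
    [T2Space X] (h : ℕ → C(X, ℝ)) (h0 : ∀ n x, 0 ≤ h n x) {C : ℝ} (hC : ∀ n x, h n x ≤ C)
    (lim : ∀ x, Tendsto (fun n => h n x) atTop (𝓝 0)) {δ : ℝ} (hδ : 0 < δ) :
    ∃ g ∈ convexHull ℝ (range h), ∀ x, g x < δ := by
  by_contra! hcon
  let s : Set C(X, ℝ) := {g | ∀ x, g x < δ}
  have hs : IsOpen s := by
    have := ContinuousMap.isOpen_setOfPred_mapsTo (X := X) (Y := ℝ) isCompact_univ
      (isOpen_Iio (a := δ))
    convert this using 1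
    ext g
    simp [s, MapsTo]
  have hsc : Convex ℝ s := by
    intro a ha b hb p q hp hq hpq x
    exact (convex_Iio δ) (ha x) (hb x) hp hq hpq
  have hd : Disjoint s (convexHull ℝ (range h)) :=
    disjoint_left.2 fun g hg hg' => by
      obtain ⟨x, hx⟩ := hcon g hg'
      exact (hg x).not_ge hx
  obtain ⟨L, c, hLs, hLt⟩ := geometric_hahn_banach_open hsc hs (convex_convexHull ℝ _) hd
  have hc : 0 < c := by simpa using hLs 0 (fun x => hδ)
  -- `s` contains every nonpositive function, which forces `L` to be positive
  have hpos : ∀ g : C(X, ℝ), (∀ x, 0 ≤ g x) → 0 ≤ L g := by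
    intro g hg
    by_contra! hneg
    have h1 := hLs ((c / L g) • g) (fun x => lt_of_le_of_lt
      (mul_nonpos_of_nonpos_of_nonneg (div_nonpos_of_nonneg_of_nonpos hc.le hneg.le) (hg x)) hδ)
    rw [map_smul, smul_eq_mul, div_mul_cancel₀ _ hneg.ne] at h1
    exact lt_irrefl _ h1
  let _ : MeasurableSpace X := borel X
  have : BorelSpace X := ⟨rfl⟩
  let Λ : CompactlySupportedContinuousMap X ℝ →ₚ[ℝ] ℝ := PositiveLinearMap.mk₀
    { toFun := fun g => L g.toContinuousMap
      map_add' := fun a b => L.map_add a.toContinuousMap b.toContinuousMap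
      map_smul' := fun a b => L.map_smul a b.toContinuousMap } (fun g hg => hpos _ hg)
  have hint : ∀ n, c ≤ ∫ x, h n x ∂(RealRMK.rieszMeasure Λ) := by
    intro n
    have h1 := RealRMK.integral_rieszMeasure Λ
      (CompactlySupportedContinuousMap.continuousMapEquiv (h n))
    exact (hLt _ (subset_convexHull ℝ _ ⟨n, rfl⟩)).trans h1.ge
  have hlim : Tendsto (fun n => ∫ x, h n x ∂(RealRMK.rieszMeasure Λ)) atTop
      (𝓝 (∫ _x, (0 : ℝ) ∂(RealRMK.rieszMeasure Λ))) := by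
    refine MeasureTheory.tendsto_integral_of_dominated_convergence (fun _ => C)
      (fun n => (h n).continuous.aestronglyMeasurable) ?_ ?_ ?_
    · exact MeasureTheory.integrable_const C
    · intro n
      exact Eventually.of_forall fun x => by
        rw [Real.norm_of_nonneg (h0 n x)]
        exact hC n x
    · exact Eventually.of_forall lim
  rw [MeasureTheory.integral_zero] at hlim
  exact hc.not_ge (ge_of_tendsto' hlim hint)

/-! ### Functionals on the dual space that are represented by vectors -/

section

variable {F : Type v} [NormedAddCommGroup F] [NormedSpace ℂ F]

/-- A functional on `F^*` that is small on the annihilator of a finite set is close to a vector of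
`F`: by Hahn–Banach it differs from a functional of norm at most `ε` by one that vanishes on the
whole annihilator, hence by a linear combination of evaluations. -/
theorem exists_norm_sub_inclusion_le (Λ : StrongDual ℂ (StrongDual ℂ F)) (S : Finset F) {ε : ℝ}
    (hε : 0 ≤ ε) (h : ∀ φ : StrongDual ℂ F, (∀ x ∈ S, φ x = 0) → ‖Λ φ‖ ≤ ε * ‖φ‖) :
    ∃ y : F, ‖Λ - NormedSpace.inclusionInDoubleDual ℂ F y‖ ≤ ε := by
  let J : F → Module.Dual ℂ (StrongDual ℂ F) :=
    fun x => (NormedSpace.inclusionInDoubleDual ℂ F x).toLinearMap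
  let p : Submodule ℂ (StrongDual ℂ F) := ⨅ x : S, (J x).ker
  have hp : ∀ φ, φ ∈ p ↔ ∀ x ∈ S, φ x = 0 := by
    intro φ
    simp [p, J, Submodule.mem_iInf]
  obtain ⟨Λ', hΛ', hn⟩ := exists_extension_norm_eq p (Λ.domRestrict p)
  have hle : ‖Λ'‖ ≤ ε := by
    rw [hn]
    exact ContinuousLinearMap.opNorm_le_bound _ hε fun φ => h φ ((hp φ).1 φ.2)
  have hker : ⨅ x : S, (J x).ker ≤ (Λ - Λ').toLinearMap.ker := by
    intro φ hφ
    have h1 : Λ' φ = Λ φ := hΛ' ⟨φ, hφ⟩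
    simp [h1]
  obtain ⟨c, hc⟩ := (Submodule.mem_span_range_iff_exists_fun ℂ).1
    (mem_span_of_iInf_ker_le_ker hker)
  refine ⟨∑ x : S, c x • (x : F), ?_⟩
  have h2 : Λ - NormedSpace.inclusionInDoubleDual ℂ F (∑ x : S, c x • (x : F)) = Λ' := by
    ext φ
    have h3 := LinearMap.congr_fun hc φ
    simp only [J, LinearMap.sum_apply, LinearMap.smul_apply, ContinuousLinearMap.coe_coe,
      NormedSpace.dual_def, _root_.sub_apply] at h3 ⊢
    rw [map_sum]
    simp only [map_smul]
    rw [h3]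
    simp
  rw [h2]
  exact hle

/-- The canonical copy of a Banach space in its bidual is closed. -/
theorem mem_range_inclusion_of_approx [CompleteSpace F] (Λ : StrongDual ℂ (StrongDual ℂ F))
    (h : ∀ ε > 0, ∃ y : F, ‖Λ - NormedSpace.inclusionInDoubleDual ℂ F y‖ ≤ ε) :
    ∃ y : F, ∀ φ : StrongDual ℂ F, φ y = Λ φ := by
  let J := NormedSpace.inclusionInDoubleDualLi (E := F) ℂ
  have hcl : IsClosed (range J) := J.isometry.isUniformInducing.isComplete_range.isClosed
  have hmem : Λ ∈ closure (range J) := by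
    refine (Metric.mem_closure_iff (α := StrongDual ℂ (StrongDual ℂ F))).2 fun ε hε => ?_
    obtain ⟨y, hy⟩ := h (ε / 2) (half_pos hε)
    refine ⟨J y, ⟨y, rfl⟩, ?_⟩
    exact (dist_eq_norm Λ (J y)).trans_lt (hy.trans_lt (half_lt_self hε))
  obtain ⟨y, hy⟩ := hcl.closure_subset hmem
  exact ⟨y, fun φ => DFunLike.congr_fun hy φ⟩

/-- It suffices that the functional is weak* continuous on the unit ball: a weak* neighbourhood of
`0` contains the annihilator of a finite set. -/
theorem mem_range_inclusion_of_continuousOn_ball [CompleteSpace F]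
    (Λ : StrongDual ℂ (StrongDual ℂ F))
    (h : ContinuousOn (fun φ : WeakDual ℂ F => Λ (WeakDual.toStrongDual φ))
      (WeakDual.toStrongDual ⁻¹' Metric.closedBall 0 1)) :
    ∃ y : F, ∀ φ : StrongDual ℂ F, φ y = Λ φ := by
  refine mem_range_inclusion_of_approx Λ fun ε hε => ?_
  have h0 := h 0 (by simp)
  rw [ContinuousWithinAt, Metric.tendsto_nhds] at h0
  have h1 := mem_nhdsWithin_iff_exists_mem_nhds_inter.1 (h0 ε hε)
  obtain ⟨V, hV, hVs⟩ := h1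
  obtain ⟨S, r, hr, hS⟩ := ((WeakDual.withSeminorms ℂ F).mem_nhds_iff _ _).1 hV
  refine exists_norm_sub_inclusion_le Λ S hε.le fun φ hφ => ?_
  rcases eq_or_ne φ 0 with rfl | hne
  · simp
  have hn : 0 < ‖φ‖ := norm_pos_iff.2 hne
  have h2 := hVs (a := ((‖φ‖ : ℂ)⁻¹ • φ).toWeakDual) ⟨hS ?_, ?_⟩
  · have h3 : ‖Λ ((‖φ‖ : ℂ)⁻¹ • φ)‖ < ε := by simpa using h2
    rw [map_smul, norm_smul, norm_inv, Complex.norm_real, norm_norm, inv_mul_lt_iff₀ hn] at h3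
    linarith
  · rw [Seminorm.mem_ball]
    refine Seminorm.finset_sup_apply_lt hr fun x hx => ?_
    rw [sub_zero, WeakDual.seminormFamily_apply]
    have h4 : ((‖φ‖ : ℂ)⁻¹ • φ).toWeakDual x = 0 := by
      rw [StrongDual.toWeakDual_apply]; simp [hφ x hx]
    rw [h4, norm_zero]
    exact hr
  · simp [norm_smul, hn.ne']

end

/-! ### Functionals dominated by a weakly compact set -/

section

variable {F : Type v} [NormedAddCommGroup F] [NormedSpace ℂ F]

/-- The convex hull of a finite set of functionals is compact, so finitely many points of `K`
suffice to bound all of its members from below. -/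
theorem exists_finset_forall_convexHull {Λ : StrongDual ℂ (StrongDual ℂ F)} {K : Set F} {ε δ : ℝ}
    (h : ∀ φ : StrongDual ℂ F, Λ φ = ε → ∃ x ∈ K, δ < ‖φ x‖) (A : Finset (StrongDual ℂ F))
    (hA : ∀ φ ∈ A, Λ φ = ε) :
    ∃ S : Finset F, (S : Set F) ⊆ K ∧
      ∀ φ ∈ convexHull ℝ (A : Set (StrongDual ℂ F)), ∃ x ∈ S, δ < ‖φ x‖ := by
  classical
  have hconv : convexHull ℝ (A : Set (StrongDual ℂ F)) ⊆ {φ | Λ φ = ε} := by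
    refine convexHull_min hA fun a ha b hb p q hp hq hpq => ?_
    simp only [mem_ofPred_eq] at ha hb ⊢
    rw [map_add, ← Complex.coe_smul, ← Complex.coe_smul, map_smul, map_smul, ha, hb,
      ← add_smul, ← Complex.ofReal_add, hpq]
    simp
  obtain ⟨t, ht⟩ := A.finite_toSet.isCompact_convexHull (𝕜 := ℝ) |>.elim_finite_subcover
    (fun x : K => {φ : StrongDual ℂ F | δ < ‖φ x‖})
    (fun x => isOpen_lt continuous_const (by fun_prop))
    (fun φ hφ => by
      obtain ⟨x, hx, hlt⟩ := h φ (hconv hφ)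
      exact mem_iUnion.2 ⟨⟨x, hx⟩, hlt⟩)
  refine ⟨t.image Subtype.val, ?_, fun φ hφ => ?_⟩
  · intro x hx
    obtain ⟨y, -, rfl⟩ := Finset.mem_image.1 (Finset.mem_coe.1 hx)
    exact y.2
  · obtain ⟨x, hx⟩ := mem_iUnion.1 (ht hφ)
    obtain ⟨hxt, hlt⟩ := mem_iUnion.1 hx
    exact ⟨x, Finset.mem_image_of_mem _ hxt, hlt⟩

theorem tendsto_apply_closure_span {φ : ℕ → StrongDual ℂ F} (hφ : ∀ n, ‖φ n‖ ≤ 1) {K : Set F}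
    (h : ∀ x ∈ K, Tendsto (fun n => φ n x) atTop (𝓝 0)) {x : F}
    (hx : x ∈ closure (Submodule.span ℂ K : Set F)) :
    Tendsto (fun n => φ n x) atTop (𝓝 0) := by
  have hspan : ∀ y ∈ Submodule.span ℂ K, Tendsto (fun n => φ n y) atTop (𝓝 0) := by
    intro y hy
    induction hy using Submodule.span_induction with
    | mem y hy => exact h y hy
    | zero => simp
    | add y z _ _ hy hz => simpa using hy.add hz
    | smul c y _ hy => simpa using hy.const_smul c
  rw [Metric.tendsto_atTop]
  intro ε hε
  obtain ⟨y, hy, hxy⟩ := Metric.mem_closure_iff.1 hx (ε / 2) (half_pos hε)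
  obtain ⟨N, hN⟩ := Metric.tendsto_atTop.1 (hspan y hy) (ε / 2) (half_pos hε)
  refine ⟨N, fun n hn => ?_⟩
  have h1 := hN n hn
  rw [dist_zero_right] at h1 ⊢
  rw [dist_eq_norm] at hxy
  have h2 : ‖φ n (x - y)‖ ≤ ‖x - y‖ :=
    ((φ n).le_of_opNorm_le (hφ n) _).trans_eq (one_mul _)
  calc ‖φ n x‖ = ‖φ n (x - y) + φ n y‖ := by rw [map_sub, sub_add_cancel]
    _ ≤ ‖φ n (x - y)‖ + ‖φ n y‖ := norm_add_le _ _
    _ < ε := by linarith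

/-- Mazur's theorem for a bounded sequence of functionals that tends to `0` pointwise on a weakly
compact set, with the absolute values handled by `exists_mem_convexHull_forall_lt`. -/
theorem exists_convexHull_forall_norm_lt {k : Set (WeakSpace ℂ F)} (hk : IsCompact k) {R : ℝ}
    (φ : ℕ → StrongDual ℂ F) (hR : ∀ n, ∀ w ∈ k, ‖φ n ((toWeakSpace ℂ F).symm w)‖ ≤ R)
    (hlim : ∀ w ∈ k, Tendsto (fun n => φ n ((toWeakSpace ℂ F).symm w)) atTop (𝓝 0))
    {δ : ℝ} (hδ : 0 < δ) :
    ∃ ψ ∈ convexHull ℝ (range φ), ∀ w ∈ k, ‖ψ ((toWeakSpace ℂ F).symm w)‖ < δ := by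
  have := isCompact_iff_compactSpace.1 hk
  have hcont : ∀ ψ : StrongDual ℂ F, Continuous fun w : k => ψ ((toWeakSpace ℂ F).symm w) :=
    fun ψ => (WeakBilin.eval_continuous (topDualPairing ℂ F).flip ψ).comp continuous_subtype_val
  let h : ℕ → C(k, ℝ) := fun n => ⟨fun w => ‖φ n ((toWeakSpace ℂ F).symm w)‖, (hcont _).norm⟩
  obtain ⟨g, hg, hgδ⟩ := exists_mem_convexHull_forall_lt h
    (fun n x => norm_nonneg (φ n ((toWeakSpace ℂ F).symm x)))
    (fun n x => hR n x x.2) (fun x => by simpa [h] using (hlim x x.2).norm) hδ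
  have hsub : convexHull ℝ (range h) ⊆ {g : C(k, ℝ) | ∃ ψ ∈ convexHull ℝ (range φ),
      ∀ w : k, ‖ψ ((toWeakSpace ℂ F).symm w)‖ ≤ g w} := by
    refine convexHull_min ?_ ?_
    · rintro _ ⟨n, rfl⟩
      exact ⟨φ n, subset_convexHull ℝ _ ⟨n, rfl⟩, fun w => le_rfl⟩
    · rintro a ⟨ψ, hψ, ha⟩ b ⟨χ, hχ, hb⟩ p q hp hq hpq
      refine ⟨p • ψ + q • χ, convex_convexHull ℝ _ hψ hχ hp hq hpq, fun w => ?_⟩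
      calc ‖(p • ψ + q • χ) ((toWeakSpace ℂ F).symm w)‖
          ≤ ‖p • ψ ((toWeakSpace ℂ F).symm w)‖ + ‖q • χ ((toWeakSpace ℂ F).symm w)‖ :=
            norm_add_le _ _
        _ = p * ‖ψ ((toWeakSpace ℂ F).symm w)‖ + q * ‖χ ((toWeakSpace ℂ F).symm w)‖ := by
            rw [norm_smul, norm_smul, Real.norm_of_nonneg hp, Real.norm_of_nonneg hq]
        _ ≤ p * a w + q * b w := by
            have := ha w
            have := hb w
            gcongr
  obtain ⟨ψ, hψ, hle⟩ := hsub hg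
  exact ⟨ψ, hψ, fun w hw => (hle ⟨w, hw⟩).trans_lt (hgδ ⟨w, hw⟩)⟩

/-- A form of Krein's theorem on closed convex hulls of weakly compact sets: a functional on `F^*`
dominated by the supremum over a relatively weakly compact set is represented by a vector of `F`.

If `Λ` stays at distance more than `ε` from `F`, there are functionals `φ` in the unit ball with
`Λ φ = ε` that vanish on any given finite set. Choosing them successively, together with finite subsets
of `K` on which the convex hulls of the earlier ones are large, yields a sequence that tends to `0`
on a weakly compact part of `K` although every convex combination of it is larger than `ε / 2`
somewhere on that part. This contradicts `exists_convexHull_forall_norm_lt`. -/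
theorem mem_range_inclusion_of_isRelWeaklyCompact [CompleteSpace F] {K : Set F}
    (hK : IsRelWeaklyCompact K) {R : ℝ} (hR : ∀ x ∈ K, ‖x‖ ≤ R)
    (Λ : StrongDual ℂ (StrongDual ℂ F))
    (hΛ : ∀ (φ : StrongDual ℂ F) (c : ℝ), 0 ≤ c → (∀ x ∈ K, ‖φ x‖ ≤ c) → ‖Λ φ‖ ≤ c) :
    ∃ y : F, ∀ φ : StrongDual ℂ F, φ y = Λ φ := by
  classical
  by_contra hcon
  have hfar : ∃ ε > 0, ∀ y : F, ε < ‖Λ - NormedSpace.inclusionInDoubleDual ℂ F y‖ := by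
    by_contra! h
    exact hcon (mem_range_inclusion_of_approx Λ h)
  obtain ⟨ε, hε, hfar⟩ := hfar
  have pick : ∀ S : Finset F, ∃ φ : StrongDual ℂ F, ‖φ‖ ≤ 1 ∧ Λ φ = ε ∧ ∀ x ∈ S, φ x = 0 := by
    intro S
    by_contra! h
    obtain ⟨y, hy⟩ := exists_norm_sub_inclusion_le Λ S hε.le fun φ hφ => by
      by_contra! hlt
      have hne : Λ φ ≠ 0 := norm_pos_iff.1 (lt_of_le_of_lt (by positivity) hlt)
      obtain ⟨x, hx, hx0⟩ := h (((ε : ℂ) / Λ φ) • φ) (by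
        rw [norm_smul, norm_div, Complex.norm_real, Real.norm_of_nonneg hε.le,
          div_mul_eq_mul_div, div_le_one (norm_pos_iff.2 hne)]
        exact hlt.le) (by rw [map_smul, smul_eq_mul, div_mul_cancel₀ _ hne])
      exact hx0 (by simp [hφ x hx])
    exact (hfar y).not_ge hy
  have hK' : ∀ φ : StrongDual ℂ F, Λ φ = ε → ∃ x ∈ K, ε / 2 < ‖φ x‖ := by
    intro φ hφ
    by_contra! h
    have h1 := hΛ φ (ε / 2) (by positivity) h
    rw [hφ, Complex.norm_real, Real.norm_of_nonneg hε.le] at h1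
    linarith
  choose! cover hcK hc using fun A hA => exists_finset_forall_convexHull hK' A hA
  -- each new functional vanishes on the finite sets norming the hulls of the earlier ones
  obtain ⟨a, ha, har⟩ := exists_seq_of_forall_finset_exists
    (α := Finset (StrongDual ℂ F) × StrongDual ℂ F)
    (fun p => (∀ φ ∈ insert p.2 p.1, Λ φ = ε) ∧ ‖p.2‖ ≤ 1)
    (fun p q => insert p.2 p.1 ⊆ q.1 ∧ ∀ x ∈ cover (insert p.2 p.1), q.2 x = 0)
    (by
      intro s hs
      obtain ⟨φ, h1, h2, h3⟩ := pick (s.biUnion fun p => cover (insert p.2 p.1))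
      refine ⟨(s.biUnion fun p => insert p.2 p.1, φ), ⟨?_, h1⟩, fun p hp => ⟨?_, ?_⟩⟩
      · intro χ hχ
        rcases Finset.mem_insert.1 hχ with rfl | hχ
        · exact h2
        · obtain ⟨p, hp, hχp⟩ := Finset.mem_biUnion.1 hχ
          exact (hs p hp).1 χ hχp
      · exact Finset.subset_biUnion_of_mem (fun p : Finset (StrongDual ℂ F) × StrongDual ℂ F =>
          insert p.2 p.1) hp
      · exact fun x hx => h3 x (Finset.mem_biUnion.2 ⟨p, hp, hx⟩))
  let B : ℕ → Finset (StrongDual ℂ F) := fun n => insert (a n).2 (a n).1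
  have hBmono : Monotone B := monotone_nat_of_le_succ fun n =>
    ((har n (n + 1) n.lt_succ_self).1).trans (Finset.subset_insert _ _)
  let K₀ : Set F := ⋃ n, (cover (B n) : Set F)
  have hφ0 : ∀ x ∈ K₀, Tendsto (fun n => (a n).2 x) atTop (𝓝 0) := by
    intro x hx
    obtain ⟨m, hm⟩ := mem_iUnion.1 hx
    refine tendsto_const_nhds.congr' ?_
    filter_upwards [eventually_gt_atTop m] with n hn
    exact ((har m n hn).2 x hm).symm
  have hK₀ : K₀ ⊆ K := iUnion_subset fun n => hcK _ (ha n).1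
  let k : Set (WeakSpace ℂ F) := closure (toWeakSpace ℂ F '' K) ∩
    toWeakSpace ℂ F '' closure (Submodule.span ℂ K₀ : Set F)
  have hk : IsCompact k := by
    refine hK.inter_right ?_
    have hconv : Convex ℝ (Submodule.span ℂ K₀ : Set F) :=
      ((Submodule.span ℂ K₀).restrictScalars ℝ).convex
    rw [hconv.toWeakSpace_closure (𝕜 := ℂ)]
    exact isClosed_closure
  have hkR : ∀ n, ∀ w ∈ k, ‖(a n).2 ((toWeakSpace ℂ F).symm w)‖ ≤ R := by
    intro n w hw
    have hcl : IsClosed {w : WeakSpace ℂ F | ‖(a n).2 ((toWeakSpace ℂ F).symm w)‖ ≤ R} :=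
      isClosed_le (WeakBilin.eval_continuous (topDualPairing ℂ F).flip (a n).2).norm
        continuous_const
    refine closure_minimal ?_ hcl hw.1
    rintro _ ⟨x, hx, rfl⟩
    exact (((a n).2.le_of_opNorm_le (ha n).2 _).trans_eq (one_mul _)).trans (hR x hx)
  have hklim : ∀ w ∈ k, Tendsto (fun n => (a n).2 ((toWeakSpace ℂ F).symm w)) atTop (𝓝 0) := by
    rintro _ ⟨-, x, hx, rfl⟩
    exact tendsto_apply_closure_span (fun n => (ha n).2) hφ0 hx
  obtain ⟨ψ, hψ, hψlt⟩ := exists_convexHull_forall_norm_lt hk _ hkR hklim (half_pos hε)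
  have hψB : ∃ n, ψ ∈ convexHull ℝ (B n : Set (StrongDual ℂ F)) := by
    have hmono : Monotone fun n => convexHull ℝ (B n : Set (StrongDual ℂ F)) :=
      fun m n hmn => convexHull_mono (Finset.coe_subset.2 (hBmono hmn))
    refine mem_iUnion.1 (convexHull_min ?_ ?_ hψ)
    · rintro _ ⟨n, rfl⟩
      exact mem_iUnion.2 ⟨n, subset_convexHull ℝ _ (by simp [B])⟩
    · exact hmono.directed_le.convex_iUnion fun n => convex_convexHull ℝ _
  obtain ⟨n, hn⟩ := hψB
  obtain ⟨x, hx, hlt⟩ := hc (B n) (ha n).1 ψ hn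
  have hxK₀ : x ∈ K₀ := mem_iUnion.2 ⟨n, hx⟩
  refine (hψlt (toWeakSpace ℂ F x) ⟨subset_closure ⟨x, hK₀ hxK₀, rfl⟩, x,
    subset_closure (Submodule.subset_span hxK₀), rfl⟩).not_gt ?_
  simpa using hlt

end

/-! ### Weak compactness and the transpose -/

section

variable {E : Type u} [NormedAddCommGroup E] [NormedSpace ℂ E]
variable {F : Type v} [NormedAddCommGroup F] [NormedSpace ℂ F]
variable {X : Type*} [NormedAddCommGroup X] [NormedSpace ℂ X]

/-- An operator `S : F^* → X` whose adjoint maps `X^*` into the canonical copy of `F` in the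
bidual `F^{**}`. -/
def AdjointMapsIntoPredual (S : StrongDual ℂ F →L[ℂ] X) : Prop :=
  ∀ μ : StrongDual ℂ X, ∃ y : F, ∀ φ : StrongDual ℂ F, φ y = μ (S φ)

theorem IsRelWeaklyCompact.mono {A B : Set F} (hB : IsRelWeaklyCompact B) (h : A ⊆ B) :
    IsRelWeaklyCompact A :=
  hB.of_isClosed_subset isClosed_closure (closure_mono (image_mono h))

theorem isRelWeaklyCompact_of_subset_compact {A : Set F} {k : Set (WeakSpace ℂ F)}
    (hk : IsCompact k) (h : ∀ x ∈ A, toWeakSpace ℂ F x ∈ k) : IsRelWeaklyCompact A :=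
  hk.closure_of_subset (image_subset_iff.2 h)

theorem isRelWeaklyCompact_image {A : Set X} (hA : IsRelWeaklyCompact A) (T : X →L[ℂ] F) :
    IsRelWeaklyCompact (T '' A) := by
  refine isRelWeaklyCompact_of_subset_compact (hA.image (WeakSpace.map T).continuous) ?_
  rintro _ ⟨x, hx, rfl⟩
  exact ⟨toWeakSpace ℂ X x, subset_closure ⟨x, hx, rfl⟩, rfl⟩

theorem IsReflexiveSpace.isRelWeaklyCompact (hX : IsReflexiveSpace X) {A : Set X}
    (hA : Bornology.IsBounded A) : IsRelWeaklyCompact A := by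
  refine NormedSpace.isCompact_closure_of_isBounded ℂ X _ ?_ ?_
  · rwa [preimage_image_eq _ (toWeakSpace ℂ X).injective]
  · intro Λ _
    obtain ⟨x, hx⟩ := hX (WeakDual.toStrongDual Λ)
    exact ⟨toWeakSpace ℂ X x, hx⟩

theorem AdjointMapsIntoPredual.isWeakStarToWeakContinuous {S : StrongDual ℂ F →L[ℂ] X}
    (hS : AdjointMapsIntoPredual S) : IsWeakStarToWeakContinuous S := by
  refine WeakBilin.continuous_of_continuous_eval _ fun μ => ?_
  obtain ⟨y, hy⟩ := hS μ
  exact (WeakDual.eval_continuous y).congr fun φ => hy _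

theorem adjointMapsIntoPredual_of_continuousOn_ball [CompleteSpace F]
    {S : StrongDual ℂ F →L[ℂ] X}
    (hS : ContinuousOn (fun φ : WeakDual ℂ F => toWeakSpace ℂ X (S (WeakDual.toStrongDual φ)))
      (WeakDual.toStrongDual ⁻¹' Metric.closedBall 0 1)) : AdjointMapsIntoPredual S :=
  fun μ => mem_range_inclusion_of_continuousOn_ball (μ.comp S)
    ((WeakBilin.eval_continuous (topDualPairing ℂ X).flip μ).comp_continuousOn hS)

theorem IsWeakStarToWeakContinuous.isWeaklyCompactOp {S : StrongDual ℂ F →L[ℂ] X}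
    (hS : IsWeakStarToWeakContinuous S) : IsWeaklyCompactOp S := by
  refine isRelWeaklyCompact_of_subset_compact
    ((WeakDual.isCompact_closedBall (𝕜 := ℂ) (E := F) 0 1).image hS) ?_
  rintro _ ⟨φ, hφ, rfl⟩
  exact ⟨φ.toWeakDual, by simpa using hφ, rfl⟩

/-- The adjoint of `S` is continuous from the weak* topology of `X^*` to the weak topology of `F`,
so it carries the weak* compact unit ball to a weakly compact set. -/
theorem AdjointMapsIntoPredual.isRelWeaklyCompact {S : StrongDual ℂ F →L[ℂ] X}
    (hS : AdjointMapsIntoPredual S) :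
    IsRelWeaklyCompact
      {y : F | ∃ μ : StrongDual ℂ X, ‖μ‖ ≤ 1 ∧ ∀ φ : StrongDual ℂ F, φ y = μ (S φ)} := by
  choose r hr using hS
  have hcont : Continuous fun μ : WeakDual ℂ X => toWeakSpace ℂ F (r (WeakDual.toStrongDual μ)) :=
    WeakBilin.continuous_of_continuous_eval _ fun φ =>
      (WeakDual.eval_continuous (S φ)).congr fun μ => (hr _ φ).symm
  refine isRelWeaklyCompact_of_subset_compact
    ((WeakDual.isCompact_closedBall (𝕜 := ℂ) (E := X) 0 1).image hcont) ?_
  rintro y ⟨μ, hμ, hy⟩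
  refine ⟨μ.toWeakDual, by simpa using hμ, ?_⟩
  refine congrArg _ ((SeparatingDual.eq_iff_forall_dual_eq (R := ℂ)).2 fun φ => ?_)
  exact (hr μ φ).trans (hy φ).symm

/-- For `μ` in the dual of `H^∞(U)`, the functional `φ ↦ μ (φ ∘ f)` is dominated by the supremum
over `f(U)`, up to a factor, so Krein's theorem applies. -/
theorem adjointMapsIntoPredual_transpose_of_range [CompleteSpace F] {U : Opens E} (f : HInfty U F)
    (hf : IsRelWeaklyCompact (range f)) : AdjointMapsIntoPredual (transpose f) := by
  intro μ
  have hK : ∀ φ : StrongDual ℂ F, ∀ c : ℝ, 0 ≤ c → (∀ x ∈ range f, ‖φ x‖ ≤ c) →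
      ‖transpose f φ‖ ≤ c :=
    fun φ c hc h => (HInfty.norm_le _ hc).2 fun x => h _ ⟨x, rfl⟩
  -- the factor `‖μ‖ + 1` serves in place of `‖μ‖` because it does not vanish
  have hM : (0 : ℝ) < ‖μ‖ + 1 := by positivity
  have hM' : ((‖μ‖ + 1 : ℝ) : ℂ) ≠ 0 := Complex.ofReal_ne_zero.2 hM.ne'
  obtain ⟨y, hy⟩ := mem_range_inclusion_of_isRelWeaklyCompact hf (R := ‖f‖)
    (by rintro _ ⟨x, rfl⟩; exact f.norm_apply_le x)
    (((‖μ‖ + 1 : ℝ) : ℂ)⁻¹ • μ.comp (transpose f)) (fun φ c hc h => by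
      rw [_root_.smul_apply, norm_smul, norm_inv, Complex.norm_real,
        Real.norm_of_nonneg hM.le, inv_mul_le_iff₀ hM]
      calc ‖μ (transpose f φ)‖ ≤ ‖μ‖ * ‖transpose f φ‖ := μ.le_opNorm _
        _ ≤ (‖μ‖ + 1) * c := by
          have := hK φ c hc h
          gcongr
          linarith)
  refine ⟨((‖μ‖ + 1 : ℝ) : ℂ) • y, fun φ => ?_⟩
  rw [map_smul, hy φ, _root_.smul_apply, smul_inv_smul₀ hM']
  rfl

/-- On the weakly compact closure of the image of the ball, the weak topology coincides with the
coarser Hausdorff topology of pointwise convergence on `U`, and `φ ↦ φ ∘ f` is continuous from the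
weak* topology to the latter. -/
theorem adjointMapsIntoPredual_transpose_of_isWeaklyCompactOp [CompleteSpace F] {U : Opens E}
    (f : HInfty U F) (hf : IsWeaklyCompactOp (transpose f)) :
    AdjointMapsIntoPredual (transpose f) := by
  refine adjointMapsIntoPredual_of_continuousOn_ball ?_
  let b : Set (WeakDual ℂ F) := WeakDual.toStrongDual ⁻¹' Metric.closedBall 0 1
  let k : Set (WeakSpace ℂ (HInfty U ℂ)) :=
    closure (toWeakSpace ℂ _ '' (transpose f '' Metric.closedBall 0 1))
  have : CompactSpace k := isCompact_iff_compactSpace.1 hf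
  let ev : k → U → ℂ := fun h x => ((toWeakSpace ℂ (HInfty U ℂ)).symm h : HInfty U ℂ) x
  have hev : Continuous ev := continuous_pi fun x =>
    (WeakBilin.eval_continuous (topDualPairing ℂ (HInfty U ℂ)).flip (delta U x)).comp
      continuous_subtype_val
  have hinj : Function.Injective ev := fun h₁ h₂ h =>
    Subtype.ext (Subtype.ext (DFunLike.coe_injective h))
  have hemb := hev.isClosedEmbedding hinj
  let q : b → k := fun φ => ⟨toWeakSpace ℂ _ (transpose f (WeakDual.toStrongDual φ.1)),
    subset_closure ⟨_, ⟨_, φ.2, rfl⟩, rfl⟩⟩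
  have hq : Continuous q := by
    refine hemb.isInducing.continuous_iff.2 (continuous_pi fun x => ?_)
    exact (WeakDual.eval_continuous (f x)).comp continuous_subtype_val
  exact continuousOn_iff_continuous_domRestrict.2 (continuous_subtype_val.comp hq)

theorem AdjointMapsIntoPredual.isWeaklyCompactOp_linearization [CompleteSpace F] {U : Opens E}
    {f : HInfty U F} (hf : AdjointMapsIntoPredual (transpose f)) :
    IsWeaklyCompactOp (linearization f) := by
  refine hf.isRelWeaklyCompact.mono ?_
  rintro _ ⟨γ, hγ, rfl⟩
  refine ⟨GInfty.incl U γ, ?_, apply_linearization f γ⟩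
  rw [(GInfty.incl U).norm_map]
  simpa using hγ

theorem norm_deltaU_le (U : Opens E) (x : U) : ‖deltaU U x‖ ≤ 1 := by
  rw [← (GInfty.incl U).norm_map, GInfty.incl_deltaU]
  exact LinearMap.mkContinuous_norm_le _ zero_le_one _

theorem isRelWeaklyCompact_range_of_isWeaklyCompactOp_linearization [CompleteSpace F]
    {U : Opens E} (f : HInfty U F) (hf : IsWeaklyCompactOp (linearization f)) :
    IsRelWeaklyCompact (range f) := by
  refine hf.mono ?_
  rintro _ ⟨x, rfl⟩
  exact ⟨deltaU U x, by simpa using norm_deltaU_le U x, linearization_deltaU f x⟩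

theorem isRelWeaklyCompact_range_of_factorization {U : Opens E} (f : HInfty U F)
    (hX : IsReflexiveSpace X) (T : X →L[ℂ] F) (g : HInfty U X) (h : ∀ x : U, f x = T (g x)) :
    IsRelWeaklyCompact (range f) := by
  have hg : Bornology.IsBounded (range g) :=
    isBounded_iff_forall_norm_le.2 ⟨‖g‖, by rintro _ ⟨x, rfl⟩; exact g.norm_apply_le x⟩
  refine (isRelWeaklyCompact_image (hX.isRelWeaklyCompact hg) T).mono ?_
  rintro _ ⟨x, rfl⟩
  exact ⟨g x, ⟨x, rfl⟩, (h x).symm⟩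

end

/-! ### The bidual of an `ℓ²`-sum, and mappings into closed subspaces -/

section

section Bidual

theorem l2_sum_norm_sq_le {Y : Type*} [NormedAddCommGroup Y] (z : lp (fun _ : ℕ => Y) 2)
    (s : Finset ℕ) : ∑ n ∈ s, ‖z n‖ ^ 2 ≤ ‖z‖ ^ 2 := by
  simpa using lp.sum_rpow_le_norm_rpow (p := 2) (by simp) z s

variable {Y : Type*} [NormedAddCommGroup Y] [NormedSpace ℂ Y]

theorem l2_norm_sum_eval_le (χ : ℕ → StrongDual ℂ Y) (s : Finset ℕ) :
    ‖∑ n ∈ s, (χ n).comp (lp.evalCLM ℂ (fun _ : ℕ => Y) 2 n)‖ ≤ √(∑ n ∈ s, ‖χ n‖ ^ 2) := by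
  refine ContinuousLinearMap.opNorm_le_bound _ (Real.sqrt_nonneg _) fun z => ?_
  calc ‖(∑ n ∈ s, (χ n).comp (lp.evalCLM ℂ (fun _ : ℕ => Y) 2 n)) z‖
      = ‖∑ n ∈ s, χ n (z n)‖ := by
        rw [_root_.sum_apply]; rfl
    _ ≤ ∑ n ∈ s, ‖χ n‖ * ‖z n‖ := norm_sum_le_of_le _ fun n _ => (χ n).le_opNorm _
    _ ≤ √(∑ n ∈ s, ‖χ n‖ ^ 2) * √(∑ n ∈ s, ‖z n‖ ^ 2) := Real.sum_mul_le_sqrt_mul_sqrt _ _ _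
    _ ≤ √(∑ n ∈ s, ‖χ n‖ ^ 2) * ‖z‖ := by
        gcongr
        exact Real.sqrt_le_iff.2 ⟨norm_nonneg _, l2_sum_norm_sq_le z s⟩

/-- The restrictions of a functional to the summands of an `ℓ²`-sum have square summable norms.
Testing the functional on vectors that norm the restrictions up to a factor `2` gives the bound
`(2‖θ‖)²`. -/
theorem l2_summable_sq_norm_comp_single (θ : StrongDual ℂ (lp (fun _ : ℕ => Y) 2)) :
    Summable fun n =>
      ‖θ.comp (lp.singleContinuousLinearMap ℂ (fun _ : ℕ => Y) 2 n)‖ ^ 2 := by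
  let χ : ℕ → StrongDual ℂ Y := fun n =>
    θ.comp (lp.singleContinuousLinearMap ℂ (fun _ : ℕ => Y) 2 n)
  have hz : ∀ n, ∃ z : Y, ‖z‖ ≤ 1 ∧ ∃ r : ℝ, χ n z = r ∧ ‖χ n‖ / 2 ≤ r := by
    intro n
    rcases eq_or_ne (χ n) 0 with h0 | h0
    · exact ⟨0, by simp, 0, by simp, by simp [h0]⟩
    obtain ⟨z, hz1, hz2⟩ := (χ n).exists_lt_apply_of_lt_opNorm
      (half_lt_self (norm_pos_iff.2 h0))
    have hne : χ n z ≠ 0 := norm_pos_iff.1 (lt_of_le_of_lt (by positivity) hz2)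
    refine ⟨((‖χ n z‖ : ℂ) / χ n z) • z, ?_, ‖χ n z‖, ?_, hz2.le⟩
    · rw [norm_smul, norm_div, Complex.norm_real, norm_norm, div_self (norm_ne_zero_iff.2 hne),
        one_mul]
      exact hz1.le
    · rw [map_smul, smul_eq_mul, div_mul_cancel₀ _ hne]
  choose z hz1 r hzr hr using hz
  refine summable_of_sum_le (c := (2 * ‖θ‖) ^ 2) (fun n => by positivity) fun s => ?_
  change ∑ n ∈ s, ‖χ n‖ ^ 2 ≤ _
  let σ := ∑ n ∈ s, ‖χ n‖ ^ 2
  have hσ : 0 ≤ σ := Finset.sum_nonneg fun n _ => by positivity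
  let v : lp (fun _ : ℕ => Y) 2 := ∑ n ∈ s, lp.single 2 n ((‖χ n‖ : ℂ) • z n)
  have hv : ‖v‖ ^ 2 ≤ σ := by
    have h1 := lp.norm_sum_single (p := 2) (E := fun _ : ℕ => Y) (by simp)
      (fun n => (‖χ n‖ : ℂ) • z n) s
    have h2 : ‖v‖ ^ 2 = ∑ n ∈ s, ‖(‖χ n‖ : ℂ) • z n‖ ^ 2 := by
      simpa only [ENNReal.toReal_ofNat, Real.rpow_ofNat] using h1
    rw [h2]
    refine Finset.sum_le_sum fun n _ => ?_
    rw [norm_smul, Complex.norm_real, norm_norm]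
    have := mul_le_of_le_one_right (norm_nonneg (χ n)) (hz1 n)
    gcongr
  have hθv : θ v = ((∑ n ∈ s, ‖χ n‖ * r n : ℝ) : ℂ) := by
    simp only [v, map_sum, Complex.ofReal_sum, Complex.ofReal_mul]
    refine Finset.sum_congr rfl fun n _ => ?_
    have h1 : θ (lp.single 2 n ((‖χ n‖ : ℂ) • z n)) = χ n ((‖χ n‖ : ℂ) • z n) := rfl
    rw [h1, map_smul, hzr, smul_eq_mul]
  have hlow : σ / 2 ≤ ‖θ v‖ := by
    rw [hθv, Complex.norm_real]
    refine le_trans ?_ (le_abs_self _)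
    rw [Finset.sum_div]
    refine Finset.sum_le_sum fun n _ => ?_
    nlinarith [hr n, norm_nonneg (χ n)]
  have hup : ‖θ v‖ ≤ ‖θ‖ * √σ :=
    (θ.le_opNorm v).trans (mul_le_mul_of_nonneg_left (Real.le_sqrt_of_sq_le hv) (norm_nonneg _))
  have h3 : √σ ≤ 2 * ‖θ‖ := by
    rcases hσ.eq_or_lt with h0 | h0
    · rw [← h0, Real.sqrt_zero]; positivity
    have h4 : 0 < √σ := Real.sqrt_pos.2 h0
    have h5 : √σ * √σ = σ := Real.mul_self_sqrt hσ
    by_contra! hlt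
    nlinarith
  calc σ = √σ ^ 2 := (Real.sq_sqrt hσ).symm
    _ ≤ (2 * ‖θ‖) ^ 2 := by gcongr

/-- In norm, every functional on an `ℓ²`-sum is the sum of its restrictions to the summands. -/
theorem l2_hasSum_functional (θ : StrongDual ℂ (lp (fun _ : ℕ => Y) 2)) :
    HasSum (fun n => (θ.comp (lp.singleContinuousLinearMap ℂ (fun _ : ℕ => Y) 2 n)).comp
      (lp.evalCLM ℂ (fun _ : ℕ => Y) 2 n)) θ := by
  have hsum : Summable fun n =>
      (θ.comp (lp.singleContinuousLinearMap ℂ (fun _ : ℕ => Y) 2 n)).comp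
        (lp.evalCLM ℂ (fun _ : ℕ => Y) 2 n) := by
    rw [summable_iff_vanishing_norm]
    intro ε hε
    obtain ⟨s, hs⟩ := summable_iff_vanishing_norm.1 (l2_summable_sq_norm_comp_single θ) (ε ^ 2)
      (by positivity)
    refine ⟨s, fun t ht => (l2_norm_sum_eval_le _ t).trans_lt ?_⟩
    exact (Real.sqrt_lt' hε).2 ((le_abs_self _).trans_lt (hs t ht))
  convert hsum.hasSum using 1
  ext z
  have h1 := (lp.hasSum_single (E := fun _ : ℕ => Y) (p := 2) (by simp) z).mapL θ
  have h2 := hsum.hasSum.mapL (ContinuousLinearMap.apply ℂ ℂ z)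
  exact h1.unique h2

/-- An element of the bidual of an `ℓ²`-sum whose coordinates all lie in the summands comes from the
`ℓ²`-sum itself. -/
theorem l2_exists_of_coordinates (Γ : StrongDual ℂ (StrongDual ℂ (lp (fun _ : ℕ => Y) 2)))
    (w : ℕ → Y) (h : ∀ (n : ℕ) (χ : StrongDual ℂ Y),
      Γ (χ.comp (lp.evalCLM ℂ (fun _ : ℕ => Y) 2 n)) = χ (w n)) :
    ∃ z : lp (fun _ : ℕ => Y) 2, (∀ n, z n = w n) ∧ ∀ θ, Γ θ = θ z := by
  -- testing `Γ` on functionals that norm finitely many `w n` bounds their `ℓ²`-norm by `‖Γ‖`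
  have hw : Memℓp w 2 := by
    refine memℓp_gen' (C := ‖Γ‖ ^ 2) fun s => ?_
    have hs : ∑ n ∈ s, ‖w n‖ ^ (2 : ℝ≥0∞).toReal = ∑ n ∈ s, ‖w n‖ ^ 2 := by simp
    rw [hs]
    choose χ hχ1 hχ using fun n => exists_dual_vector'' ℂ (w n)
    let σ := ∑ n ∈ s, ‖w n‖ ^ 2
    have hσ : 0 ≤ σ := Finset.sum_nonneg fun n _ => by positivity
    let θ : StrongDual ℂ (lp (fun _ : ℕ => Y) 2) :=
      ∑ n ∈ s, ((‖w n‖ : ℂ) • χ n).comp (lp.evalCLM ℂ (fun _ : ℕ => Y) 2 n)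
    have hθ : ‖θ‖ ≤ √σ := by
      refine (l2_norm_sum_eval_le _ s).trans (Real.sqrt_le_sqrt (Finset.sum_le_sum fun n _ => ?_))
      rw [norm_smul, Complex.norm_real, norm_norm]
      have := mul_le_of_le_one_right (norm_nonneg (w n)) (hχ1 n)
      gcongr
    have hΓθ : Γ θ = (σ : ℂ) := by
      simp only [θ, map_sum, h, σ, Complex.ofReal_sum]
      refine Finset.sum_congr rfl fun n _ => ?_
      rw [_root_.smul_apply, hχ, smul_eq_mul, sq, Complex.ofReal_mul]
      rfl
    have h1 : σ ≤ ‖Γ‖ * √σ := by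
      have h2 := (Γ.le_opNorm θ).trans (mul_le_mul_of_nonneg_left hθ (norm_nonneg _))
      rwa [hΓθ, Complex.norm_real, Real.norm_of_nonneg hσ] at h2
    have h3 : √σ ≤ ‖Γ‖ := by
      rcases hσ.eq_or_lt with h0 | h0
      · rw [← h0, Real.sqrt_zero]; positivity
      have h4 : 0 < √σ := Real.sqrt_pos.2 h0
      have h5 : √σ * √σ = σ := Real.mul_self_sqrt hσ
      by_contra! hlt
      nlinarith
    calc σ = √σ ^ 2 := (Real.sq_sqrt hσ).symm
      _ ≤ ‖Γ‖ ^ 2 := by gcongr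
  refine ⟨⟨w, hw⟩, fun n => rfl, fun θ => ?_⟩
  have h1 := (l2_hasSum_functional θ).mapL Γ
  have h2 := (l2_hasSum_functional θ).mapL
    (ContinuousLinearMap.apply ℂ ℂ (⟨w, hw⟩ : lp (fun _ : ℕ => Y) 2))
  simp only [h] at h1
  exact h1.unique h2

end Bidual

section Closed

variable {E : Type*} [NormedAddCommGroup E] [NormedSpace ℂ E]
variable {Z : Type*} [NormedAddCommGroup Z] [NormedSpace ℂ Z]

/-- The derivative takes values in the closed subspace, being a limit of difference quotients. -/
theorem differentiableAt_of_coe {p : Submodule ℂ Z} (hp : IsClosed (p : Set Z)) {h : E → p}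
    {x : E} (hd : DifferentiableAt ℂ (fun y => (h y : Z)) x) : DifferentiableAt ℂ h x := by
  have hmem : ∀ v, fderiv ℂ (fun y => (h y : Z)) x v ∈ p := by
    intro v
    have h1 : HasDerivAt (fun t : ℂ => (h (x + t • v) : Z)) (fderiv ℂ (fun y => (h y : Z)) x v) 0 :=
      hd.hasFDerivAt.hasLineDerivAt v
    have h2 := range_deriv_subset_closure_span_image (fun t : ℂ => (h (x + t • v) : Z))
      dense_univ ⟨0, rfl⟩
    rw [h1.deriv] at h2
    refine closure_minimal ?_ hp h2
    refine Submodule.span_le.2 ?_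
    rintro _ ⟨t, -, rfl⟩
    exact (h (x + t • v)).2
  refine ⟨(fderiv ℂ (fun y => (h y : Z)) x).codRestrict p hmem, ?_⟩
  have h3 := hd.hasFDerivAt.isLittleO
  refine HasFDerivAt.of_isLittleO ?_
  exact (Asymptotics.isLittleO_norm_left.1 (Asymptotics.isLittleO_norm_left.2 h3 :))

end Closed

end

/-! ### Factorization through a reflexive space -/

section

variable {F : Type v} [NormedAddCommGroup F] [NormedSpace ℂ F]
variable {X : Type*} [NormedAddCommGroup X] [NormedSpace ℂ X]

/-- A functional on `F^*` bounded by `a‖S φ‖ + b‖φ‖` is the sum of one that factors through `S` and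
one of norm at most `b`: extend it from the graph of `S` to the product by Hahn–Banach. -/
theorem exists_norm_sub_comp_le (S : StrongDual ℂ F →L[ℂ] X) (Λ : StrongDual ℂ (StrongDual ℂ F))
    {a b : ℝ} (ha : 0 ≤ a) (hb : 0 ≤ b) (h : ∀ φ, ‖Λ φ‖ ≤ a * ‖S φ‖ + b * ‖φ‖) :
    ∃ μ : StrongDual ℂ X, ‖Λ - μ.comp S‖ ≤ b := by
  let q : Seminorm ℂ (StrongDual ℂ F × X) :=
    (a.toNNReal • (normSeminorm ℂ X).comp
      (LinearMap.snd ℂ (StrongDual ℂ F) X)) +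
      (b.toNNReal • (normSeminorm ℂ (StrongDual ℂ F)).comp
        (LinearMap.fst ℂ (StrongDual ℂ F) X))
  have hq : ∀ φ x, q (φ, x) = a * ‖x‖ + b * ‖φ‖ := by
    intro φ x
    simp [q, NNReal.smul_def, ha, hb]
  have hqc : Continuous q := by
    have : (q : StrongDual ℂ F × X → ℝ) = fun z => a * ‖z.2‖ + b * ‖z.1‖ :=
      funext fun z => hq z.1 z.2
    rw [this]
    fun_prop
  obtain ⟨g, hg, hgq⟩ := Module.Dual.exists_continuous_extension_of_le_seminorm
    (S.toLinearMap.graph) (Λ.toLinearMap ∘ₗ LinearMap.fst ℂ _ _ ∘ₗ S.toLinearMap.graph.subtype) hqc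
    (by
      rintro ⟨⟨φ, x⟩, hx⟩
      have hx' : x = S φ := hx
      subst hx'
      exact (h φ).trans_eq (hq φ (S φ)).symm)
  refine ⟨g.comp (ContinuousLinearMap.inr ℂ _ _), ?_⟩
  refine ContinuousLinearMap.opNorm_le_bound _ hb fun φ => ?_
  have h1 : g (φ, S φ) = Λ φ := hg ⟨(φ, S φ), rfl⟩
  have h2 : (Λ - (g.comp (ContinuousLinearMap.inr ℂ _ _)).comp S) φ = g (φ, 0) := by
    change Λ φ - g (0, S φ) = _
    rw [← h1, ← map_sub]
    simp
  rw [h2]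
  exact (hgq (φ, 0)).trans_eq (by rw [hq]; simp)

/-- The norm `φ ↦ 2ⁿ‖S φ‖ + 2⁻ⁿ‖φ‖` on `F^*`, equivalent to the original one. -/
def interpNorm (S : StrongDual ℂ F →L[ℂ] X) (n : ℕ) (φ : StrongDual ℂ F) : ℝ :=
  2 ^ n * ‖S φ‖ + (2 ^ n)⁻¹ * ‖φ‖

theorem norm_le_interpNorm (S : StrongDual ℂ F →L[ℂ] X) (n : ℕ) (φ : StrongDual ℂ F) :
    ‖φ‖ ≤ 2 ^ n * interpNorm S n φ := by
  rw [interpNorm, mul_add, mul_inv_cancel_left₀ (by positivity)]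
  exact le_add_of_nonneg_left (by positivity)

theorem interpNorm_pos (S : StrongDual ℂ F →L[ℂ] X) (n : ℕ) {φ : StrongDual ℂ F} (hφ : φ ≠ 0) :
    0 < interpNorm S n φ := by
  have := norm_pos_iff.2 hφ
  rw [interpNorm]
  positivity

theorem interpNorm_nonneg (S : StrongDual ℂ F →L[ℂ] X) (n : ℕ) (φ : StrongDual ℂ F) :
    0 ≤ interpNorm S n φ := by
  rw [interpNorm]
  positivity

theorem norm_inv_interpNorm_mul_le {S : StrongDual ℂ F →L[ℂ] X} {n : ℕ} {x : F} {c : ℝ}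
    (hc : 0 ≤ c) {φ : StrongDual ℂ F} (h : ‖φ x‖ ≤ c * interpNorm S n φ) :
    ‖((interpNorm S n φ : ℝ) : ℂ)⁻¹ * φ x‖ ≤ c := by
  rcases eq_or_ne φ 0 with rfl | hφ
  · simpa using hc
  rw [norm_mul, norm_inv, Complex.norm_real, Real.norm_of_nonneg (interpNorm_nonneg S n φ),
    inv_mul_le_iff₀ (interpNorm_pos S n hφ), mul_comm]
  exact h

theorem norm_apply_le_two_pow_mul (S : StrongDual ℂ F →L[ℂ] X) (n : ℕ) (x : F)
    (φ : StrongDual ℂ F) : ‖φ x‖ ≤ 2 ^ n * ‖x‖ * interpNorm S n φ :=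
  calc ‖φ x‖ ≤ ‖φ‖ * ‖x‖ := φ.le_opNorm x
    _ ≤ (2 ^ n * interpNorm S n φ) * ‖x‖ := by
      gcongr
      exact norm_le_interpNorm S n φ
    _ = _ := by ring

/-- The space `ℓ^∞(F^*)` of bounded complex functions on the set `F^*`. -/
def DualBounded (F : Type v) [NormedAddCommGroup F] [NormedSpace ℂ F] : Type v :=
  lp (fun _ : StrongDual ℂ F => ℂ) ∞

instance : NormedAddCommGroup (DualBounded F) :=
  inferInstanceAs (NormedAddCommGroup (lp (fun _ : StrongDual ℂ F => ℂ) ∞))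

instance : NormedSpace ℂ (DualBounded F) :=
  inferInstanceAs (NormedSpace ℂ (lp (fun _ : StrongDual ℂ F => ℂ) ∞))

instance : CompleteSpace (DualBounded F) :=
  inferInstanceAs (CompleteSpace (lp (fun _ : StrongDual ℂ F => ℂ) ∞))

/-- The space `F` renormed by the predual of `interpNorm S n`, realized in `ℓ^∞(F^*)` through
`x ↦ (φ(x) / interpNorm S n φ)_φ`; the coordinate at `φ = 0` is `0`. -/
def interpMap (S : StrongDual ℂ F →L[ℂ] X) (n : ℕ) :
    F →L[ℂ] DualBounded F :=
  LinearMap.mkContinuous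
    { toFun := fun x => show lp (fun _ : StrongDual ℂ F => ℂ) ∞ from
        ⟨fun φ => ((interpNorm S n φ : ℝ) : ℂ)⁻¹ * φ x,
        memℓp_infty ⟨2 ^ n * ‖x‖, by
          rintro _ ⟨φ, rfl⟩
          exact norm_inv_interpNorm_mul_le (by positivity) (norm_apply_le_two_pow_mul S n x φ)⟩⟩
      map_add' := fun x y => lp.ext (funext fun φ =>
        (congrArg _ (map_add φ x y)).trans (mul_add _ (φ x) (φ y)))
      map_smul' := fun c x => lp.ext (funext fun φ =>
        (congrArg _ (map_smul φ c x)).trans (mul_left_comm _ c (φ x))) } (2 ^ n)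
    (fun x => lp.norm_le_of_forall_le (by positivity) fun φ =>
      norm_inv_interpNorm_mul_le (by positivity) (norm_apply_le_two_pow_mul S n x φ))

theorem norm_interpMap_le (S : StrongDual ℂ F →L[ℂ] X) (n : ℕ) {x : F}
    (h : ∀ φ : StrongDual ℂ F, ‖φ x‖ ≤ ‖S φ‖) : ‖interpMap S n x‖ ≤ (2 ^ n)⁻¹ := by
  refine lp.norm_le_of_forall_le (by positivity) fun φ =>
    norm_inv_interpNorm_mul_le (by positivity) ((h φ).trans ?_)
  rw [interpNorm, mul_add, inv_mul_cancel_left₀ (by positivity)]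
  exact le_add_of_nonneg_right (by positivity)

theorem norm_apply_le_interpNorm_mul (S : StrongDual ℂ F →L[ℂ] X) (n : ℕ) (x : F)
    (φ : StrongDual ℂ F) : ‖φ x‖ ≤ interpNorm S n φ * ‖interpMap S n x‖ := by
  rcases eq_or_ne φ 0 with rfl | hφ
  · simpa using mul_nonneg (interpNorm_nonneg S n 0) (norm_nonneg _)
  have h1 : ‖((interpNorm S n φ : ℝ) : ℂ)⁻¹ * φ x‖ ≤ ‖interpMap S n x‖ :=
    lp.norm_apply_le_norm (E := fun _ : StrongDual ℂ F => ℂ) ENNReal.top_ne_zero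
      (show lp (fun _ : StrongDual ℂ F => ℂ) ∞ from interpMap S n x) φ
  rwa [norm_mul, norm_inv, Complex.norm_real, Real.norm_of_nonneg (interpNorm_nonneg S n φ),
    inv_mul_le_iff₀ (interpNorm_pos S n hφ)] at h1

/-- The Davis–Figiel–Johnson–Pełczyński space: those `x ∈ F` whose norms `‖interpMap S n x‖`
are square summable over `n`. It is encoded by the pairs of `x` and the sequence
`(interpMap S n x)ₙ`, which makes it a closed subspace of a product and its inclusion into `F` a
projection. -/
def interpSubmodule (S : StrongDual ℂ F →L[ℂ] X) :
    Submodule ℂ (F × lp (fun _ : ℕ => DualBounded F) 2) where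
  carrier := {p | ∀ n, p.2 n = interpMap S n p.1}
  add_mem' := fun {p q} hp hq n => by
    change p.2 n + q.2 n = _
    rw [hp n, hq n, Prod.fst_add, map_add]
  zero_mem' := fun n => (map_zero (interpMap S n)).symm
  smul_mem' := fun c p hp n => by
    change c • p.2 n = _
    rw [hp n, Prod.smul_fst, map_smul]

theorem isClosed_interpSubmodule (S : StrongDual ℂ F →L[ℂ] X) :
    IsClosed (interpSubmodule S : Set (F × lp (fun _ : ℕ => DualBounded F) 2)) := by
  have : (interpSubmodule S : Set (F × lp (fun _ : ℕ => DualBounded F) 2)) =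
      ⋂ n, {p | lp.evalCLM ℂ (fun _ : ℕ => DualBounded F) 2 n p.2 =
        interpMap S n p.1} := by
    ext p
    simp only [mem_iInter]
    rfl
  rw [this]
  exact isClosed_iInter fun n => isClosed_eq
    ((lp.evalCLM ℂ _ 2 n).continuous.comp continuous_snd)
    ((interpMap S n).continuous.comp continuous_fst)

/-- Let `Ψ` be in the bidual and `Λ` its image in `F^{**}`. Then `Λ` is bounded by a multiple of
every `interpNorm S n`, so `exists_norm_sub_comp_le` puts it within distance `‖Ψ‖ 2⁻ⁿ` of `F`. Hence
`Λ` is a vector of `F`, and `l2_exists_of_coordinates` shows that this vector belongs to the space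
and represents `Ψ`. -/
theorem isReflexiveSpace_interpSubmodule [CompleteSpace F] {S : StrongDual ℂ F →L[ℂ] X}
    (hS : AdjointMapsIntoPredual S) : IsReflexiveSpace (interpSubmodule S) := by
  intro Ψ
  let Z := lp (fun _ : ℕ => DualBounded F) 2
  let G := interpSubmodule S
  let j : G →L[ℂ] F := (ContinuousLinearMap.fst ℂ F Z).comp G.subtypeL
  let k : G →L[ℂ] Z := (ContinuousLinearMap.snd ℂ F Z).comp G.subtypeL
  let Λ : StrongDual ℂ (StrongDual ℂ F) := Ψ.comp (ContinuousLinearMap.precomp ℂ j)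
  let Γ : StrongDual ℂ (StrongDual ℂ Z) := Ψ.comp (ContinuousLinearMap.precomp ℂ k)
  have hΛ : ∀ n φ, ‖Λ φ‖ ≤ ‖Ψ‖ * interpNorm S n φ := by
    intro n φ
    refine (Ψ.le_opNorm (φ.comp j)).trans ?_
    gcongr
    refine ContinuousLinearMap.opNorm_le_bound _ (interpNorm_nonneg S n φ) fun z => ?_
    refine (norm_apply_le_interpNorm_mul S n (j z) φ).trans ?_
    have h1 : ‖interpMap S n (j z)‖ ≤ ‖z‖ := by
      have h2 : interpMap S n (j z) = k z n := (z.2 n).symm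
      rw [h2]
      exact (lp.norm_apply_le_norm two_ne_zero (k z) n).trans (norm_snd_le z.1)
    have := interpNorm_nonneg S n φ
    gcongr
  obtain ⟨y, hy⟩ := mem_range_inclusion_of_approx Λ fun ε hε => by
    obtain ⟨n, hn⟩ := exists_pow_lt_of_lt_one (show 0 < ε / (‖Ψ‖ + 1) by positivity)
      (show (2 : ℝ)⁻¹ < 1 by norm_num)
    obtain ⟨μ, hμ⟩ := exists_norm_sub_comp_le S Λ (a := ‖Ψ‖ * 2 ^ n) (b := ‖Ψ‖ * (2 ^ n)⁻¹)
      (by positivity) (by positivity) (fun φ => (hΛ n φ).trans_eq (by rw [interpNorm]; ring))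
    obtain ⟨y, hy⟩ := hS μ
    refine ⟨y, ?_⟩
    have h1 : NormedSpace.inclusionInDoubleDual ℂ F y = μ.comp S :=
      ContinuousLinearMap.ext fun φ => hy φ
    rw [h1]
    refine hμ.trans ?_
    rw [inv_pow, lt_div_iff₀ (by positivity)] at hn
    have : (0 : ℝ) < (2 ^ n)⁻¹ := by positivity
    nlinarith
  obtain ⟨z, hz, hzθ⟩ := l2_exists_of_coordinates Γ (fun n => interpMap S n y) fun n χ => by
    rw [← ContinuousLinearMap.comp_apply, hy]
    refine congrArg Ψ ?_
    ext p
    exact congrArg χ (p.2 n)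
  refine ⟨⟨(y, z), hz⟩, ?_⟩
  ext θ
  -- a functional on the space extends to the product, hence splits along the two factors
  obtain ⟨g, hg, -⟩ := exists_extension_norm_eq G θ
  have h1 : θ = (g.comp (ContinuousLinearMap.inl ℂ F Z)).comp j +
      (g.comp (ContinuousLinearMap.inr ℂ F Z)).comp k := by
    ext p
    rw [← hg p]
    change g p.1 = g (p.1.1, 0) + g (0, p.1.2)
    rw [← map_add]
    simp
  have h2 : Ψ θ = g (y, 0) + g (0, z) := by
    rw [h1, map_add]
    exact congrArg₂ (· + ·) (hy _).symm (hzθ _)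
  rw [h2, NormedSpace.dual_def, ← hg, ← map_add]
  simp

section Factorization

variable {E : Type u} [NormedAddCommGroup E] [NormedSpace ℂ E]

/-- The Schwarz lemma bounds the derivatives of the terms on a smaller ball by a summable sequence.
-/
theorem differentiableAt_tsum_of_norm_le {Z : Type*} [NormedAddCommGroup Z] [NormedSpace ℂ Z]
    [CompleteSpace Z] {U : Opens E} {h : ℕ → E → Z} (hd : ∀ n, DifferentiableOn ℂ (h n) (U : Set E))
    {c : ℕ → ℝ} (hc : Summable c) (hh : ∀ n, ∀ x ∈ U, ‖h n x‖ ≤ c n) {x : E} (hx : x ∈ U) :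
    DifferentiableAt ℂ (fun y => ∑' n, h n y) x := by
  obtain ⟨r, hr, hrU⟩ := Metric.isOpen_iff.1 U.isOpen x hx
  have hr2 : 0 < r / 2 := half_pos hr
  have hball : ∀ y ∈ Metric.ball x (r / 2), Metric.ball y (r / 2) ⊆ (U : Set E) := by
    intro y hy
    refine (Metric.ball_subset_ball' ?_).trans hrU
    have := Metric.mem_ball.1 hy
    linarith
  have hsub : Metric.ball x (r / 2) ⊆ (U : Set E) := hball x (Metric.mem_ball_self hr2)
  refine (hasFDerivAt_tsum_of_isPreconnected (f' := fun n y => fderiv ℂ (h n) y)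
    (u := fun n => 2 * c n / (r / 2)) ((hc.mul_left 2).div_const _) Metric.isOpen_ball
    (convex_ball x (r / 2)).isPreconnected (fun n y hy => ?_) (fun n y hy => ?_)
    (Metric.mem_ball_self hr2) (Summable.of_norm_bounded hc fun n => hh n x hx)
    (Metric.mem_ball_self hr2)).differentiableAt
  · exact ((hd n).differentiableAt (U.isOpen.mem_nhds (hsub hy))).hasFDerivAt
  · refine Complex.norm_fderiv_le_div_of_mapsTo_ball ((hd n).mono (hball y hy)) ?_ hr2
    intro w hw
    rw [Metric.mem_closedBall, dist_eq_norm]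
    have h1 := hh n w (hball y hy hw)
    have h2 := hh n y (hsub hy)
    linarith [norm_sub_le (h n w) (h n y)]

/-- The mapping `g` sends `x` to `f x` together with its renormed copies. Since `‖φ (f x)‖ ≤ ‖f^t
φ‖`, the `n`-th copy has norm at most `2⁻ⁿ`, so the series of copies is holomorphic. -/
theorem exists_reflexive_factorization [CompleteSpace F] {U : Opens E} (f : HInfty U F)
    (hf : AdjointMapsIntoPredual (transpose f)) :
    ∃ (G : Type v) (_ : NormedAddCommGroup G) (_ : NormedSpace ℂ G) (_ : CompleteSpace G),
      IsReflexiveSpace G ∧ ∃ (T : G →L[ℂ] F) (g : HInfty U G), ∀ x : U, f x = T (g x) := by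
  classical
  obtain ⟨h, hd, he⟩ := f.2
  let S := transpose f
  let Y := DualBounded F
  let Z := lp (fun _ : ℕ => Y) 2
  let G := interpSubmodule S
  have hcomplete : CompleteSpace G := (isClosed_interpSubmodule S).completeSpace_coe
  have hi : ∀ n, ∀ x ∈ U, ‖interpMap S n (h x)‖ ≤ (2 ^ n)⁻¹ := by
    intro n x hx
    refine norm_interpMap_le S n fun φ => ?_
    rw [he ⟨x, hx⟩]
    exact (transpose f φ).norm_apply_le ⟨x, hx⟩
  let t : ℕ → E → Z := fun n x => lp.singleContinuousLinearMap ℂ (fun _ : ℕ => Y) 2 n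
    (interpMap S n (h x))
  have ht : ∀ n, ∀ x ∈ U, ‖t n x‖ ≤ (1 / 2) ^ n := by
    intro n x hx
    refine (lp.norm_single (E := fun _ : ℕ => Y) (p := 2) (by simp) n _).trans_le ?_
    rw [one_div, inv_pow]
    exact hi n x hx
  have htd : ∀ n, DifferentiableOn ℂ (t n) (U : Set E) := fun n =>
    ((lp.singleContinuousLinearMap ℂ (fun _ : ℕ => Y) 2 n).comp
      (interpMap S n)).differentiable.comp_differentiableOn hd
  let s : E → Z := fun x => ∑' n, t n x
  have hsum : ∀ x ∈ U, Summable fun n => t n x := fun x hx =>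
    Summable.of_norm_bounded summable_geometric_two fun n => ht n x hx
  have hs : ∀ x ∈ U, ∀ n, s x n = interpMap S n (h x) := by
    intro x hx n
    have h1 := (hsum x hx).hasSum.mapL (lp.evalCLM ℂ (fun _ : ℕ => Y) 2 n)
    refine h1.unique ?_
    have h2 : ∀ m, m ≠ n → lp.evalCLM ℂ (fun _ : ℕ => Y) 2 n (t m x) = 0 := fun m hm =>
      lp.single_apply_ne (E := fun _ : ℕ => Y) 2 m _ hm.symm
    have h3 := hasSum_single n h2
    have h4 : lp.evalCLM ℂ (fun _ : ℕ => Y) 2 n (t n x) = interpMap S n (h x) :=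
      lp.single_apply_self (E := fun _ : ℕ => Y) 2 n _
    rwa [h4] at h3
  have hsn : ∀ x ∈ U, ‖s x‖ ≤ 2 := fun x hx =>
    tsum_of_norm_bounded hasSum_geometric_two fun n => ht n x hx
  let g : E → G := fun x => if hx : x ∈ U then ⟨(h x, s x), hs x hx⟩ else 0
  have hg : ∀ x ∈ U, (g x : F × Z) = (h x, s x) := fun x hx => by simp [g, hx]
  have hgd : DifferentiableOn ℂ g (U : Set E) := by
    intro x hx
    have hUx : (U : Set E) ∈ 𝓝 x := U.isOpen.mem_nhds hx
    refine (differentiableAt_of_coe (isClosed_interpSubmodule S) ?_).differentiableWithinAt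
    refine DifferentiableAt.congr_of_eventuallyEq (f := fun y => (h y, s y)) ?_ ?_
    · exact (hd.differentiableAt hUx).prodMk
        (differentiableAt_tsum_of_norm_le htd summable_geometric_two ht hx)
    · filter_upwards [hUx] with y hy using hg y hy
  obtain ⟨g', hg'⟩ := HInfty.exists_of_bounded U g hgd (max ‖f‖ 2) fun x hx => by
    change ‖(g x : F × Z)‖ ≤ _
    rw [hg x hx, Prod.norm_mk]
    refine max_le_max ?_ (hsn x hx)
    rw [he ⟨x, hx⟩]
    exact f.norm_apply_le ⟨x, hx⟩
  refine ⟨G, inferInstance, inferInstance, hcomplete, isReflexiveSpace_interpSubmodule hf,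
    (ContinuousLinearMap.fst ℂ F Z).comp G.subtypeL, g', fun x => ?_⟩
  rw [hg' x]
  change f x = (g x : F × Z).1
  rw [hg x x.2]
  exact (he x).symm

end Factorization

end

end BddHolo

end

theorem mainTheorem1
    {E : Type u} [NormedAddCommGroup E] [NormedSpace ℂ E] [CompleteSpace E]
    {F : Type v} [NormedAddCommGroup F] [NormedSpace ℂ F] [CompleteSpace F]
    (U : TopologicalSpace.Opens E) (f : BddHolo.HInfty U F) :
    [ -- `f` has relatively weakly compact range
      BddHolo.IsRelWeaklyCompact (Set.range f),
      -- `T_f` is weakly compact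
      BddHolo.IsWeaklyCompactOp (BddHolo.linearization f),
      -- `f = T ∘ g` with `G` a reflexive complex Banach space
      ∃ (G : Type v) (_ : NormedAddCommGroup G) (_ : NormedSpace ℂ G) (_ : CompleteSpace G),
        BddHolo.IsReflexiveSpace G ∧
          ∃ (T : G →L[ℂ] F) (g : BddHolo.HInfty U G), ∀ x : U, f x = T (g x),
      -- `f^t` is weakly compact
      BddHolo.IsWeaklyCompactOp (BddHolo.transpose f),
      -- `f^t` is weak*-to-weak continuous
      BddHolo.IsWeakStarToWeakContinuous (BddHolo.transpose f)].TFAE := by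
  tfae_have 1 → 5 := fun h =>
    (BddHolo.adjointMapsIntoPredual_transpose_of_range f h).isWeakStarToWeakContinuous
  tfae_have 5 → 4 := fun h => h.isWeaklyCompactOp
  tfae_have 4 → 2 := fun h =>
    (BddHolo.adjointMapsIntoPredual_transpose_of_isWeaklyCompactOp
      f h).isWeaklyCompactOp_linearization
  tfae_have 2 → 1 := BddHolo.isRelWeaklyCompact_range_of_isWeaklyCompactOp_linearization f
  tfae_have 1 → 3 := fun h =>
    BddHolo.exists_reflexive_factorization f (BddHolo.adjointMapsIntoPredual_transpose_of_range f h)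
  tfae_have 3 → 1 := by
    rintro ⟨G, _, _, _, hG, T, g, h⟩
    exact BddHolo.isRelWeaklyCompact_range_of_factorization f hG T g h
  tfae_finish
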